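/- All spaces are Hausdorff. A cover of a compact Hausdorff space $X$ is a pair $(Y,f)$ with $Y$ compact Hausdorff and $f\colon Y\to X$ a perfect (closed with compact fibres), irreducible continuous surjection, where irreducible means $f(F)\ne X$ for every proper closed $F\subsetneq Y$. Covers of $X$ are preordered by $(Y_1,f_1)\le (Y_2,f_2)$ iff $f_2=f_1\circ h$ for some continuous $h\colon Y_2\to Y_1$; the maximum cover of $X$ (unique up to equivalence) is its Gleason cover, written $gX$. For a compact Hausdorff space $K$, let $\mathcal S(K,g)$ be the collection of compact Hausdorff spaces $X$ with $gX=K$, that is, of pairs $(X,f)$ such that $f\colon K\to X$ is the Gleason cover of $X$, preordered by $(X_1,f_1)\le (X_2,f_2)$ iff $f_1=h\circ f_2$ for some continuous $h\colon X_2\to X_1$; pairs that are $\le$ each other are identified. **Theorem.** Let $K$ be an infinite, compact Hausdorff, extremally disconnected space. Then $gK=K$ (the identity of $K$ is the Gleason cover of $K$), and $\mathcal S(K,g)$ has a minimum if and only if $K$ is homeomorphic to the Stone–Čech compactification $\beta D$ of some discrete space $D$. In that case the minimum is the one-point compactification $\alpha D$: for every discrete $D$ and every homeomorphism $e\colon K\to\beta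 D$, the pair $(\alpha D, \pi\circ e)$, where $\pi\colon\beta D\to\alpha D$ is the continuous extension of the inclusion $D\hookrightarrow\alpha D$, belongs to $\mathcal S(K,g)$ and is a minimum of it, and for every minimum $(M,f)$ there is a homeomorphism $\varphi\colon M\to\alpha D$ with $\varphi\circ f=\pi\circ e$. -/

import Mathlib

universe u

namespace MinSpace

/-- A covering map: a perfect (closed with compact fibres) irreducible continuous surjection.
`IsProperMap f` says that `f` is continuous and closed with compact fibres
(`isProperMap_iff_isClosedMap_and_compact_fibers`). -/
structure IsCover {X Y : Type*} [TopologicalSpace X] [TopologicalSpace Y] (f : Y → X) : Prop where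
  perfect : IsProperMap f
  surjective : Function.Surjective f
  irreducible : ∀ F : Set Y, IsClosed F → F ≠ Set.univ → f '' F ≠ Set.univ

/-- The covers `(Y, f)` of `X` with `Y` compact Hausdorff. -/
structure Cov (X : Type u) [TopologicalSpace X] where
  space : CompHaus.{u}
  map : space → X
  isCover : IsCover map

/-- `(X₁, f₁) ≤ (X₂, f₂)` iff `f₂ = f₁ ∘ h` for some continuous `h : X₂ → X₁`. -/
instance (X : Type u) [TopologicalSpace X] : Preorder (Cov X) where
  le A B := ∃ h : B.space → A.space, Continuous h ∧ B.map = A.map ∘ h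
  le_refl A := ⟨id, continuous_id, rfl⟩
  le_trans A B C := by
    rintro ⟨h, hh, e⟩ ⟨k, hk, e'⟩
    exact ⟨h ∘ k, hh.comp hk, by rw [e', e]; rfl⟩

/-- `(K, f)` is the Gleason cover of `X` (up to equivalence): it is the maximum cover of `X`. -/
def IsGleasonCover {K X : Type u} [TopologicalSpace K] [CompactSpace K] [T2Space K]
    [TopologicalSpace X] (f : K → X) : Prop :=
  ∃ hf : IsCover f, IsTop (Cov.mk (CompHaus.of K) f hf)

/-- The compact Hausdorff spaces `X` with `gX = K`, each one given as a pair `(X, f)`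
where `f : K → X` is the Gleason cover of `X`. -/
structure GleasonBase (K : Type u) [TopologicalSpace K] [CompactSpace K] [T2Space K] where
  space : CompHaus.{u}
  map : K → space
  isGleasonCover : IsGleasonCover map

/-- `(X₁, f₁) ≤ (X₂, f₂)` iff `f₁ = h ∘ f₂` for some continuous `h : X₂ → X₁`. -/
instance (K : Type u) [TopologicalSpace K] [CompactSpace K] [T2Space K] :
    Preorder (GleasonBase K) where
  le A B := ∃ h : B.space → A.space, Continuous h ∧ A.map = h ∘ B.map
  le_refl A := ⟨id, continuous_id, rfl⟩
  le_trans A B C := by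
    rintro ⟨h, hh, e⟩ ⟨k, hk, e'⟩
    exact ⟨h ∘ k, hh.comp hk, by rw [e, e']; rfl⟩

/-- The canonical map `βD → αD`, extending the inclusion `D → αD` of a discrete space `D`
into its one-point compactification. -/
noncomputable def betaToAlpha (D : Type u) [TopologicalSpace D] [DiscreteTopology D] :
    StoneCech D → OnePoint D :=
  stoneCechExtend (OnePoint.continuous_coe (X := D))

end MinSpace

open Set Function

namespace MinSpace

/-! Compact extremally disconnected spaces are projective, so every cover `K → X` is a Gleason
cover, and a minimum is a coarsest cover out of `K`. A cover is injective at isolated points, while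
any two non-isolated points are identified by some cover. A minimum therefore collapses all
non-isolated points together, and irreducibility then makes the isolated points dense; `K` is the
Stone–Čech compactification of the set of these. Conversely, `βD → αD` collapses exactly the points
outside `D`, so it factors through every cover. -/

/-- A cover whose domain is extremally disconnected is the Gleason cover. -/
theorem IsCover.isGleasonCover {K X : Type u} [TopologicalSpace K] [CompactSpace K] [T2Space K]
    [ExtremallyDisconnected K] [TopologicalSpace X] [CompactSpace X] [T2Space X] {f : K → X}
    (hf : IsCover f) : IsGleasonCover f := by
  refine ⟨hf, fun A => ?_⟩
  obtain ⟨h, hh, e⟩ := CompactT2.ExtremallyDisconnected.projective (A := K)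
    hf.perfect.continuous A.isCover.perfect.continuous A.isCover.surjective
  exact ⟨h, hh, e.symm⟩

theorem isCover_id (X : Type*) [TopologicalSpace X] : IsCover (id : X → X) :=
  ⟨isProperMap_id, surjective_id, fun F _ h => by rwa [image_id]⟩

/-- A cover is injective at the isolated points of its domain. -/
theorem IsCover.eq_of_isOpen_singleton {X Y : Type*} [TopologicalSpace X] [TopologicalSpace Y]
    {f : Y → X} (hf : IsCover f) {x y : Y} (hx : IsOpen {x}) (hxy : f y = f x) : y = x := by
  by_contra hne
  refine hf.irreducible {x}ᶜ hx.isClosed_compl (fun h => ?_) (eq_univ_of_forall fun z => ?_)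
  · exact (h ▸ mem_univ x : x ∈ ({x}ᶜ : Set Y)) rfl
  · obtain ⟨w, rfl⟩ := hf.surjective z
    by_cases hw : w = x
    · exact ⟨y, hne, by rw [hxy, hw]⟩
    · exact ⟨w, hw, rfl⟩

section Dense

variable {D X Y : Type*} [TopologicalSpace X] [TopologicalSpace Y] {i : D → Y} {g : Y → X}

/-- A continuous map sending a dense family injectively to isolated points has no other points
in the fibres over these. -/
theorem eq_of_isOpen_singleton_image [T1Space Y] (hi : DenseRange i) (hg : Continuous g)
    (hinj : Injective (g ∘ i)) {d : D} (ho : IsOpen {g (i d)}) {y : Y} (hy : g y = g (i d)) :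
    y = i d := by
  by_contra hne
  obtain ⟨d', h1, h2⟩ := hi.exists_mem_open
    ((ho.preimage hg).inter (isOpen_compl_singleton (x := i d))) ⟨y, hy, hne⟩
  exact h2 (congrArg i (hinj h1))

/-- A closed set mapping onto `X` meets the fibre over each `g (i d)`. That fibre is the single
point `i d`, so the set contains a dense range. -/
theorem isCover_of_denseRange [CompactSpace Y] [T1Space Y] [T2Space X] (hi : DenseRange i)
    (hg : Continuous g) (hd : DenseRange (g ∘ i)) (hinj : Injective (g ∘ i))
    (ho : ∀ d, IsOpen {g (i d)}) : IsCover g := by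
  have hs : Surjective g := by
    rw [← range_eq_univ, ← (isCompact_range hg).isClosed.closure_eq]
    exact (hd.mono (range_comp_subset_range i g)).closure_eq
  refine ⟨hg.isProperMap, hs, fun F hF hne he => hne ?_⟩
  rw [← hF.closure_eq]
  refine (hi.mono ?_).closure_eq
  rintro _ ⟨d, rfl⟩
  obtain ⟨y, hy, e⟩ : g (i d) ∈ g '' F := he ▸ mem_univ _
  exact eq_of_isOpen_singleton_image hi hg hinj (ho d) e ▸ hy

end Dense

/-- Two non-isolated points of a compact Hausdorff space are identified by some cover. -/
theorem exists_isCover_eq {K : Type u} [TopologicalSpace K] [CompactSpace K] [T2Space K] {p q : K}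
    (hp : ¬ IsOpen {p}) (hq : ¬ IsOpen {q}) :
    ∃ (X : CompHaus.{u}) (f : K → X), IsCover f ∧ f p = f q := by
  -- The quotient gluing `p` to `q` is realised inside a product of lines, which makes it Hausdorff.
  let C := {φ : C(K, ℝ) // φ p = φ q}
  let g : K → (C → ℝ) := fun x φ => φ.1 x
  have hg : Continuous g := continuous_pi fun φ => φ.1.continuous
  have : CompactSpace (range g) := isCompact_iff_compactSpace.mp (isCompact_range hg)
  refine ⟨CompHaus.of (range g), rangeFactorization g,
    ⟨Continuous.isProperMap (hg.subtype_mk _), rangeFactorization_surjective, ?_⟩,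
    Subtype.ext (funext fun φ => φ.2)⟩
  intro F hF hne he
  -- If the nonempty open set `Fᶜ` lay in `{p, q}`, then `p` or `q` would be isolated.
  obtain ⟨z, hzF, hzp, hzq⟩ : ∃ z, z ∉ F ∧ z ≠ p ∧ z ≠ q := by
    by_contra! h
    have key : ∀ a b : K, ¬ IsOpen {a} → ¬ IsOpen {b} → a ∉ F →
        (∀ z ∉ F, z ≠ a → z = b) → False := by
      intro a b ha hb haF hz
      by_cases hab : a = b
      · refine ha ?_
        convert hF.isOpen_compl using 1
        ext z
        exact ⟨fun e => e ▸ haF, fun e => by_contra fun hza => hza ((hz z e hza).trans hab.symm)⟩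
      · refine ha ?_
        convert hF.isOpen_compl.inter (isOpen_compl_singleton (x := b)) using 1
        ext z
        exact ⟨fun e => e ▸ ⟨haF, hab⟩, fun e => by_contra fun hza => e.2 (hz z e.1 hza)⟩
    obtain ⟨a, ha⟩ := (ne_univ_iff_exists_notMem F).mp hne
    by_cases hap : a = p
    · exact key p q hp hq (hap ▸ ha) h
    · have haq := h a ha hap
      exact key q p hq hp (haq ▸ ha) fun z hz hzq => by_contra fun hzp => hzq (h z hz hzp)
  obtain ⟨y, hyF, hy⟩ : rangeFactorization g z ∈ rangeFactorization g '' F := he ▸ mem_univ _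
  have hdisj : Disjoint {z} (F ∪ {p, q}) := by
    rw [disjoint_singleton_left]
    rintro (h | h | h)
    exacts [hzF h, hzp h, hzq h]
  -- Being constant on `{p, q}`, `φ` is a coordinate of `g`, and it separates `g z` from `g '' F`.
  obtain ⟨φ, h0, h1, -⟩ := exists_continuous_zero_one_of_isClosed (isClosed_singleton (x := z))
    (hF.union (toFinite {p, q}).isClosed) hdisj
  have hpq : φ p = φ q := by
    rw [h1 (Or.inr (Or.inl rfl)), h1 (Or.inr (Or.inr rfl))]
    rfl
  have hyz : φ y = φ z := congrFun (congrArg Subtype.val hy) ⟨φ, hpq⟩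
  rw [h0 rfl, h1 (Or.inl hyF)] at hyz
  exact one_ne_zero hyz

section Minimum

variable {K : Type u} [TopologicalSpace K] [CompactSpace K] [T2Space K]

/-- If `GleasonBase K` has a minimum, then the isolated points of `K` are dense. -/
theorem dense_isolated_of_isBot [ExtremallyDisconnected K] {M : GleasonBase K} (hM : IsBot M) :
    Dense {x : K | IsOpen {x}} := by
  have hcov : IsCover M.map := M.isGleasonCover.1
  have hid : ∀ p q : K, ¬ IsOpen {p} → ¬ IsOpen {q} → M.map p = M.map q := by
    intro p q hp hq
    obtain ⟨X, f, hf, hpq⟩ := exists_isCover_eq hp hq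
    obtain ⟨h, -, e⟩ := hM ⟨X, f, hf.isGleasonCover⟩
    simp only [e, comp_apply]
    exact congrArg h hpq
  have hopen : IsOpen {x : K | IsOpen {x}} :=
    isOpen_iff_forall_mem_open.mpr fun x hx => ⟨{x}, singleton_subset_iff.mpr hx, hx, rfl⟩
  have hclopen := ExtremallyDisconnected.open_closure _ hopen
  intro p
  by_contra hp
  have hiso : ∀ x ∉ closure {x : K | IsOpen {x}}, ¬ IsOpen {x} := fun x hx h =>
    hx (subset_closure h)
  -- All points off the closure have the same image as `p`, so adding `p` alone to the closure
  -- already gives a set mapping onto the whole space.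
  refine hcov.irreducible (closure {x : K | IsOpen {x}} ∪ {p})
    (isClosed_closure.union isClosed_singleton) (fun h => ?_) (eq_univ_of_forall fun z => ?_)
  · refine hiso p hp ?_
    convert isClosed_closure.isOpen_compl (s := closure {x : K | IsOpen {x}}) using 1
    ext z
    refine ⟨fun e => e ▸ hp, fun hz => ?_⟩
    exact (h ▸ mem_univ z : z ∈ closure {x : K | IsOpen {x}} ∪ {p}).resolve_left hz
  · obtain ⟨w, rfl⟩ := hcov.surjective z
    by_cases hw : w ∈ closure {x : K | IsOpen {x}}
    · exact ⟨w, Or.inl hw, rfl⟩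
    · exact ⟨p, Or.inr rfl, hid p w (hiso p hp) (hiso w hw)⟩

/-- An extremally disconnected compact Hausdorff space with dense isolated points is the
Stone–Čech compactification of a discrete space. -/
theorem exists_homeomorph_stoneCech [ExtremallyDisconnected K]
    (hd : Dense {x : K | IsOpen {x}}) :
    ∃ (D : Type u) (_ : TopologicalSpace D) (_ : DiscreteTopology D),
      Nonempty (K ≃ₜ StoneCech D) := by
  let D := {x : K // IsOpen {x}}
  have hD : DiscreteTopology D := discreteTopology_iff_isOpen_singleton.mpr fun d => by
    convert d.2.preimage continuous_subtype_val using 1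
    ext x
    exact Subtype.ext_iff
  have hc : Continuous (Subtype.val : D → K) := continuous_subtype_val
  have he : stoneCechExtend hc ∘ stoneCechUnit = Subtype.val := stoneCechExtend_extends hc
  have hcov : IsCover (stoneCechExtend hc) := by
    refine isCover_of_denseRange denseRange_stoneCechUnit (continuous_stoneCechExtend hc)
      ?_ ?_ fun d => ?_
    · rw [he]
      exact hd.denseRange_val
    · rw [he]
      exact Subtype.val_injective
    · rw [stoneCechExtend_stoneCechUnit]
      exact d.2
  -- An irreducible surjection onto an extremally disconnected space is a homeomorphism.
  exact ⟨D, inferInstance, hD, ⟨(ExtremallyDisconnected.homeoCompactToT2 hcov.perfect.continuous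
    hcov.surjective fun F hne hF => hcov.irreducible F hF hne).symm⟩⟩

/-- Two minima of `GleasonBase K` are homeomorphic under `K`. -/
theorem exists_homeomorph_of_isBot {M N : GleasonBase K} (hM : IsBot M) (hN : IsBot N) :
    ∃ φ : M.space ≃ₜ N.space, φ ∘ M.map = N.map := by
  obtain ⟨h, hh, eh⟩ := hM N
  obtain ⟨k, hk, ek⟩ := hN M
  have hMs : Surjective M.map := M.isGleasonCover.1.surjective
  have hNs : Surjective N.map := N.isGleasonCover.1.surjective
  refine ⟨⟨⟨k, h, fun x => ?_, fun x => ?_⟩, hk, hh⟩, ek.symm⟩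
  · obtain ⟨z, rfl⟩ := hMs x
    exact (congrArg h (congrFun ek z).symm).trans (congrFun eh z).symm
  · obtain ⟨z, rfl⟩ := hNs x
    exact (congrArg k (congrFun eh z).symm).trans (congrFun ek z).symm

end Minimum

section BetaToAlpha

/-- `βD → αD` extends the inclusion of `D` into `αD`. -/
theorem betaToAlpha_comp_stoneCechUnit (D : Type u) [TopologicalSpace D] [DiscreteTopology D]
    (d : D) : betaToAlpha D (stoneCechUnit d) = (d : OnePoint D) :=
  stoneCechExtend_stoneCechUnit OnePoint.continuous_coe d

variable {K D : Type u} [TopologicalSpace K] [TopologicalSpace D]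

theorem denseRange_homeomorph_symm_comp_stoneCechUnit (e : K ≃ₜ StoneCech D) :
    DenseRange (e.symm ∘ (stoneCechUnit : D → StoneCech D)) :=
  e.symm.surjective.denseRange.comp denseRange_stoneCechUnit e.symm.continuous

variable [DiscreteTopology D] (e : K ≃ₜ StoneCech D)

theorem betaToAlpha_comp_homeomorph_symm (d : D) :
    (betaToAlpha D ∘ e) (e.symm (stoneCechUnit d)) = (d : OnePoint D) := by
  simp [betaToAlpha_comp_stoneCechUnit]

theorem continuous_betaToAlpha_comp : Continuous (betaToAlpha D ∘ e) :=
  (continuous_stoneCechExtend OnePoint.continuous_coe).comp e.continuous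

theorem isOpen_singleton_coe (d : D) : IsOpen {(d : OnePoint D)} := by
  rw [← image_singleton, OnePoint.isOpen_image_coe]
  exact isOpen_discrete _

theorem eq_of_betaToAlpha_comp_eq_coe [T2Space K] {x : K} {d : D}
    (hx : (betaToAlpha D ∘ e) x = (d : OnePoint D)) : x = e.symm (stoneCechUnit d) := by
  have hu := betaToAlpha_comp_homeomorph_symm e
  refine eq_of_isOpen_singleton_image (i := e.symm ∘ stoneCechUnit)
    (denseRange_homeomorph_symm_comp_stoneCechUnit e) (continuous_betaToAlpha_comp e) ?_ ?_ ?_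
  · exact fun a b h => OnePoint.coe_injective ((hu a).symm.trans (h.trans (hu b)))
  · exact (hu d).symm ▸ isOpen_singleton_coe d
  · exact hx.trans (hu d).symm

theorem isCover_betaToAlpha_comp [CompactSpace K] [T2Space K] [Infinite K] : IsCover (betaToAlpha D ∘ e) := by
  have hu := betaToAlpha_comp_homeomorph_symm e
  have hi := denseRange_homeomorph_symm_comp_stoneCechUnit e
  have hcomp : (betaToAlpha D ∘ e) ∘ (e.symm ∘ stoneCechUnit) = ((↑) : D → OnePoint D) :=
    funext hu
  -- For finite `D` the point `∞` would be isolated and missed.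
  have : Infinite D := by
    by_contra hfin
    rw [not_infinite_iff_finite] at hfin
    have hr := finite_range (e.symm ∘ (stoneCechUnit : D → StoneCech D))
    have := hi.closure_eq
    rw [hr.isClosed.closure_eq] at this
    exact infinite_univ (this ▸ hr)
  have : NoncompactSpace D := by
    rw [← not_compactSpace_iff]
    intro h
    exact not_finite_iff_infinite.mpr ‹Infinite D› finite_of_compact_of_discrete
  refine isCover_of_denseRange hi (continuous_betaToAlpha_comp e) ?_ ?_ fun d => ?_
  · rw [hcomp]
    exact OnePoint.denseRange_coe
  · rw [hcomp]
    exact OnePoint.coe_injective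
  · exact (hu d).symm ▸ isOpen_singleton_coe d

theorem isBot_betaToAlpha_comp [CompactSpace K] [T2Space K]
    (hf : IsGleasonCover (betaToAlpha D ∘ e)) :
    IsBot (GleasonBase.mk (CompHaus.of (OnePoint D)) (betaToAlpha D ∘ e) hf) := by
  intro B
  have hB : IsCover B.map := B.isGleasonCover.1
  have hiso : ∀ d : D, IsOpen {e.symm (stoneCechUnit d)} := fun d => by
    convert (isOpen_singleton_coe d).preimage (continuous_betaToAlpha_comp e) using 1
    ext x
    refine ⟨?_, fun h => eq_of_betaToAlpha_comp_eq_coe e h⟩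
    rintro rfl
    exact betaToAlpha_comp_homeomorph_symm e d
  have key : ∀ {x y : K} {d : D}, (betaToAlpha D ∘ e) x = (d : OnePoint D) →
      B.map y = B.map x → y = x := fun {x y d} hx h => by
    obtain rfl := eq_of_betaToAlpha_comp_eq_coe e hx
    exact hB.eq_of_isOpen_singleton (hiso d) h
  -- Points over `D` are alone in their `B.map` fibres; all others go to `∞`.
  have hfac : FactorsThrough (betaToAlpha D ∘ e) B.map := by
    intro x y h
    by_contra hne
    cases hx : (betaToAlpha D ∘ e) x using OnePoint.rec with
    | coe d => exact hne (by rw [key hx h.symm])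
    | infty =>
      cases hy : (betaToAlpha D ∘ e) y using OnePoint.rec with
      | coe d => exact hne (by rw [key hy h])
      | infty => exact hne (hx.trans hy.symm)
  have hq : Topology.IsQuotientMap B.map :=
    hB.perfect.isClosedMap.isQuotientMap hB.perfect.continuous hB.surjective
  let g : C(K, OnePoint D) := ⟨betaToAlpha D ∘ e, continuous_betaToAlpha_comp e⟩
  refine ⟨hq.lift (f := ⟨B.map, hB.perfect.continuous⟩) g hfac, ContinuousMap.continuous _, ?_⟩
  funext x
  exact (DFunLike.congr_fun
    (hq.lift_comp (f := ⟨B.map, hB.perfect.continuous⟩) g hfac) x).symm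

end BetaToAlpha

end MinSpace

theorem mainTheorem2 (K : Type u) [TopologicalSpace K] [CompactSpace K] [T2Space K]
    [Infinite K] [ExtremallyDisconnected K] :
    -- `gK = K`
    MinSpace.IsGleasonCover (id : K → K) ∧
    -- the spaces with Gleason cover `K` have a minimum iff `K` is a `βD`
    ((∃ M : MinSpace.GleasonBase K, IsBot M) ↔
      ∃ (D : Type u) (_ : TopologicalSpace D) (_ : DiscreteTopology D),
        Nonempty (K ≃ₜ StoneCech D)) ∧
    -- and in that case the minimum is `αD`
    (∀ (D : Type u) [TopologicalSpace D] [DiscreteTopology D] (e : K ≃ₜ StoneCech D),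
      (∃ hf : MinSpace.IsGleasonCover (MinSpace.betaToAlpha D ∘ e),
        IsBot (MinSpace.GleasonBase.mk (CompHaus.of (OnePoint D))
          (MinSpace.betaToAlpha D ∘ e) hf)) ∧
      ∀ M : MinSpace.GleasonBase K, IsBot M →
        ∃ φ : M.space ≃ₜ OnePoint D, φ ∘ M.map = MinSpace.betaToAlpha D ∘ e) := by
  refine ⟨(MinSpace.isCover_id K).isGleasonCover, ⟨?_, ?_⟩, fun D _ _ e => ?_⟩
  · rintro ⟨M, hM⟩
    exact MinSpace.exists_homeomorph_stoneCech (MinSpace.dense_isolated_of_isBot hM)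
  · rintro ⟨D, _, _, ⟨e⟩⟩
    exact ⟨_, MinSpace.isBot_betaToAlpha_comp e (MinSpace.isCover_betaToAlpha_comp e).isGleasonCover⟩
  · have hf := (MinSpace.isCover_betaToAlpha_comp e).isGleasonCover
    have hbot := MinSpace.isBot_betaToAlpha_comp e hf
    exact ⟨⟨hf, hbot⟩, fun M hM => MinSpace.exists_homeomorph_of_isBot hM hbot⟩
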